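/- Let $N\ge 0$ be an integer, let $F_N$ be the free group of rank $N$, let $\phi\in\mathrm{Aut}(F_N)$, and let $\Gamma=F_N\rtimes_\phi\mathbb Z$ be the semidirect product in which the generator $1\in\mathbb Z$ acts on $F_N$ by $\phi$. For a group $G$ let $\widehat G$ denote its profinite completion, that is, the inverse limit of the finite quotients of $G$ (a topological group), and let $\iota_G\colon G\to\widehat G$ be the canonical homomorphism; let $Z(\cdot)$ denote the centre. If $Z(\Gamma)\neq 1$, then \[ Z(\widehat\Gamma)=\overline{Z(\Gamma)}, \] where $\overline{Z(\Gamma)}$ is the closure in $\widehat\Gamma$ of $\iota_\Gamma(Z(\Gamma))$. Hence there is an isomorphism of topological groups \[ \widehat\Gamma/Z(\widehat\Gamma)\;\cong\;\widehat{\Gamma/Z(\Gamma)}, \] where the left-hand side has the quotient topology, and this isomorphism can be chosen to be the canonical one, sending $\iota_\Gamma(g)\,Z(\widehat\Gamma)$ to $\iota_{\Gamma/Z(\Gamma)}(g\,Z(\Gamma))$ for every $g\in\Gamma$. -/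

import Mathlib

/-- The free-by-cyclic group `F_N ⋊_φ ℤ` (with `ℤ` written multiplicatively), in which the generator
`t` of `ℤ` acts on the free group `F_N` of rank `N` by the automorphism `φ`. -/
abbrev FreeByCyclic (N : ℕ) (φ : MulAut (FreeGroup (Fin N))) : Type :=
  FreeGroup (Fin N) ⋊[zpowersHom (MulAut (FreeGroup (Fin N))) φ] Multiplicative ℤ

/-- The profinite completion of a group: Mathlib's limit, as a topological group, of the inverse
system of the finite quotients of `G`. -/
abbrev ProfiniteHat (G : Type) [Group G] : ProfiniteGrp :=
  ProfiniteGrp.ProfiniteCompletion.completion (GrpCat.of G)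

/-- The canonical homomorphism from a group to its profinite completion. -/
abbrev toHat (G : Type) [Group G] : G →* ProfiniteHat G :=
  (ProfiniteGrp.ProfiniteCompletion.eta (GrpCat.of G)).hom

open scoped commutatorElement
open CategoryTheory

/-! Write `Z` for the centre of `Γ`. The map of completions induced by `Γ → Γ/Z` is onto with kernel
the closure of `Z`. If the completion of `Γ/Z` is centreless, then the centre of the completion of
`Γ` lies in that kernel, and the closure of `Z` is central by density; this gives both claims
(`center_eq_and_exists_equiv`).

If `Z` meets `F_N` nontrivially, `Γ` is abelian and `Γ/Z` is trivial. Otherwise `F_N` embeds in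
`Γ/Z` as a normal subgroup of finite index, and `Γ/Z` is centreless. It remains to show that a
centreless virtually free group `E`, with free normal `F` of index `m`, has centreless completion.
Let `e = xg` be central there, with `x ∈ E` and `g` in the completion of `F`. Then `e^m` is trivial,
so `g` is an `m`-th root of `x^{-m}`. Such roots already lie in `F` (`exists_forall_inv_mul_mem`),
so `e` lies in `E` and is trivial.

The root statement rests on the density of the centralizer of `v ∈ F` in its centralizer in the
completion (`exists_commute_of_commutator_mem`), proved by counting crossings of one edge in a
finite Cayley graph. Up to the completion statements, everything is phrased through normal subgroups
of finite index: a relation modulo a deep `V'` yields a conclusion modulo `V`. -/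

/-! ### Residual finiteness of free groups -/

/-- A partial injection of a finite type extends to a permutation. -/
theorem exists_perm_extending {X : Type*} [Finite X] (R : X → X → Prop)
    (h₁ : ∀ a b b', R a b → R a b' → b = b') (h₂ : ∀ a a' b, R a b → R a' b → a = a') :
    ∃ σ : Equiv.Perm X, ∀ a b, R a b → σ a = b := by
  classical
  cases nonempty_fintype X
  let f : X → X := fun a => if h : ∃ b, R a b then h.choose else a
  have hf : ∀ a b, R a b → f a = b := fun a b h => by
    have h' : ∃ b, R a b := ⟨b, h⟩
    simp only [f, dif_pos h']
    exact h₁ _ _ _ h'.choose_spec h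
  obtain ⟨g, hg⟩ := Finset.exists_equiv_extend_of_card_eq (α := X) (t := (Finset.univ : Finset X))
    rfl (s := Finset.univ.filter fun a => ∃ b, R a b) (f := f) (by simp) (by
      intro a ha a' ha' h
      simp only [Finset.coe_filter, Finset.mem_univ, true_and, Set.mem_ofPred_eq] at ha ha'
      obtain ⟨b, hb⟩ := ha
      obtain ⟨b', hb'⟩ := ha'
      rw [hf _ _ hb, hf _ _ hb'] at h
      subst h
      exact h₂ _ _ _ hb hb')
  refine ⟨g.trans (Equiv.subtypeUnivEquiv fun _ => Finset.mem_univ _), fun a b h => ?_⟩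
  have := hg a (by simpa using ⟨b, h⟩)
  simpa [hf a b h] using this

namespace FreeGroup

variable {α : Type*}

theorem mk_cons (x : α × Bool) (L : List (α × Bool)) : mk (x :: L) = mk [x] * mk L := by
  rw [mul_mk]; rfl

theorem IsReduced.getElem?_succ {L : List (α × Bool)} (h : IsReduced L) {k : ℕ} {x y : α × Bool}
    (hx : L[k]? = some x) (hy : L[k + 1]? = some y) (hxy : x.1 = y.1) : x.2 = y.2 := by
  rw [List.getElem?_eq_some_iff] at hx hy
  obtain ⟨hk, rfl⟩ := hx
  obtain ⟨hk', rfl⟩ := hy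
  exact (List.isChain_iff_getElem.1 h) k hk' hxy

/-- A reduced word acts on the initial segment of the naturals indexing its suffixes by moving
the last point to the first one. -/
theorem exists_hom_perm_of_isReduced {L : List (α × Bool)} (h : IsReduced L) :
    ∃ f : FreeGroup α →* Equiv.Perm (Fin (L.length + 1)), f (mk L) (Fin.last _) = 0 := by
  let R : α → Fin (L.length + 1) → Fin (L.length + 1) → Prop := fun j a b =>
    (a.val = b.val + 1 ∧ L[b.val]? = some (j, true)) ∨
      (b.val = a.val + 1 ∧ L[a.val]? = some (j, false))
  -- A clash in `R j` would require adjacent letters `j` and `j⁻¹`, which reducedness forbids.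
  have hR : ∀ j, ∃ σ : Equiv.Perm (Fin (L.length + 1)), ∀ a b, R j a b → σ a = b := by
    intro j
    refine exists_perm_extending _ ?_ ?_
    · rintro a b b' (⟨h1, h2⟩ | ⟨h1, h2⟩) (⟨h3, h4⟩ | ⟨h3, h4⟩)
      · ext; omega
      · rw [h1] at h4
        exact absurd (h.getElem?_succ h2 h4 rfl) (by simp)
      · rw [h3] at h2
        exact absurd (h.getElem?_succ h4 h2 rfl) (by simp)
      · ext; omega
    · rintro a a' b (⟨h1, h2⟩ | ⟨h1, h2⟩) (⟨h3, h4⟩ | ⟨h3, h4⟩)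
      · ext; omega
      · rw [h3] at h2
        exact absurd (h.getElem?_succ h4 h2 rfl) (by simp)
      · rw [h1] at h4
        exact absurd (h.getElem?_succ h2 h4 rfl) (by simp)
      · ext; omega
  choose σ hσ using hR
  refine ⟨lift σ, ?_⟩
  have key : ∀ L₂ L₁ : List (α × Bool), (hL : L = L₁ ++ L₂) →
      lift σ (mk L₂) (Fin.last _) = ⟨L₁.length, by rw [hL]; simp⟩ := by
    intro L₂
    induction L₂ with
    | nil =>
      rintro L₁ hL
      rw [← one_eq_mk, _root_.map_one]
      ext
      simp [hL]
    | cons x L₂ ih =>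
      intro L₁ hL
      have := ih (L₁ ++ [x]) (by simp [hL])
      rw [mk_cons, _root_.map_mul, Equiv.Perm.mul_apply, this]
      obtain ⟨j, b⟩ := x
      cases b with
      | true =>
        have : lift σ (mk [(j, true)]) = σ j := by simp
        rw [this]
        exact hσ j _ _ (Or.inl ⟨by simp, by simp [hL]⟩)
      | false =>
        have : lift σ (mk [(j, false)]) = (σ j)⁻¹ := by simp
        rw [this, Equiv.Perm.inv_eq_iff_eq]
        exact (hσ j _ _ (Or.inr ⟨by simp, by simp [hL]⟩)).symm
  exact key L [] rfl

instance residuallyFinite : Group.ResiduallyFinite (FreeGroup α) := by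
  classical
  refine Group.residuallyFinite_iff_exists_finiteIndex.2 fun g hg => ?_
  obtain ⟨f, hf⟩ := exists_hom_perm_of_isReduced (isReduced_toWord (x := g))
  rw [mk_toWord] at hf
  refine ⟨f.ker, inferInstance, fun h => hg ?_⟩
  rw [MonoidHom.mem_ker] at h
  rw [h, Equiv.Perm.one_apply] at hf
  have := congrArg Fin.val hf
  simp only [Fin.val_last, Fin.val_zero, List.length_eq_zero_iff] at this
  rwa [toWord_eq_nil_iff] at this

end FreeGroup

/-- In a residually finite group a finite set of nontrivial elements avoids a normal subgroup of
finite index. -/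
theorem Group.ResiduallyFinite.exists_le_forall_mem {G : Type*} [Group G]
    [Group.ResiduallyFinite G] (V : FiniteIndexNormalSubgroup G) {S : Set G} (hS : S.Finite) :
    ∃ W ≤ V, ∀ x ∈ S, x ∈ W → x = 1 := by
  induction S, hS using Set.Finite.induction_on with
  | empty => exact ⟨V, le_rfl, by simp⟩
  | @insert a S _ _ ih =>
    obtain ⟨W, hW, h⟩ := ih
    by_cases ha : a = 1
    · refine ⟨W, hW, ?_⟩
      rintro x (rfl | hx) hxW
      exacts [ha, h x hx hxW]
    · obtain ⟨U, hU⟩ := Group.exists_finiteIndexNormalSubgroup_notMem a ha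
      refine ⟨W ⊓ U, inf_le_left.trans hW, ?_⟩
      rintro x (rfl | hx) hxW
      exacts [absurd (inf_le_right (a := W) hxW) hU, h x hx (inf_le_left (b := U) hxW)]

/-! ### Signed edge crossings in Cayley graphs of quotients -/

namespace FreeGroup

variable {α Q : Type*} [Group Q] (f : FreeGroup α →* Q) (x₀ : α × Bool)

open scoped Classical in
/-- The signed number of times that the letter `x`, applied to the vertex `a` of the Cayley graph
of `Q`, crosses the edge which issues from `1` in the direction `x₀`. -/
noncomputable def crossing (x : α × Bool) (a : Q) : ℤ :=
  if x = x₀ ∧ a = 1 then 1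
  else if x = (x₀.1, !x₀.2) ∧ f (mk [x]) * a = 1 then -1 else 0

/-- The signed number of crossings along the path of a word, read from its last letter. -/
noncomputable def crossings : List (α × Bool) → Q → ℤ
  | [], _ => 0
  | x :: L, a => crossing f x₀ x (f (mk L) * a) + crossings L a

theorem crossings_le_length (L : List (α × Bool)) (a : Q) : crossings f x₀ L a ≤ L.length := by
  induction L with
  | nil => simp [crossings]
  | cons x L ih =>
    have : crossing f x₀ x (f (mk L) * a) ≤ 1 := by unfold crossing; split_ifs <;> simp
    simp only [crossings, List.length_cons]
    push_cast
    linarith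

theorem exists_suffix_of_crossings_ne_zero {L : List (α × Bool)} {a : Q}
    (h : crossings f x₀ L a ≠ 0) : ∃ p, p <:+ L ∧ f (mk p) * a = 1 := by
  induction L with
  | nil => simp [crossings] at h
  | cons x L ih =>
    by_cases h' : crossings f x₀ L a = 0
    · simp only [crossings, h', add_zero, crossing] at h
      split_ifs at h with h₁ h₂
      · exact ⟨L, List.suffix_cons x L, h₁.2⟩
      · refine ⟨x :: L, List.suffix_rfl, ?_⟩
        rw [mk_cons, _root_.map_mul, mul_assoc, h₂.2]
      · exact absurd rfl h
    · obtain ⟨p, hp, h''⟩ := ih h'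
      exact ⟨p, hp.trans (List.suffix_cons x L), h''⟩

theorem crossings_nonneg {L : List (α × Bool)} {a : Q}
    (h : ∀ p, (x₀.1, !x₀.2) :: p <:+ L → f (mk ((x₀.1, !x₀.2) :: p)) * a ≠ 1) :
    0 ≤ crossings f x₀ L a := by
  induction L with
  | nil => simp [crossings]
  | cons x L ih =>
    have h₁ := ih fun p hp => h p (hp.trans (List.suffix_cons x L))
    have h₂ : 0 ≤ crossing f x₀ x (f (mk L) * a) := by
      unfold crossing
      split_ifs with h₃ h₄
      · simp
      · obtain ⟨rfl, h₄⟩ := h₄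
        refine absurd ?_ (h L List.suffix_rfl)
        rw [mk_cons, _root_.map_mul, mul_assoc, h₄]
      · simp
    simp only [crossings]
    linarith

theorem crossings_pos {L : List (α × Bool)}
    (h : ∀ p, (x₀.1, !x₀.2) :: p <:+ L ++ [x₀] → f (mk ((x₀.1, !x₀.2) :: p)) ≠ 1) :
    0 < crossings f x₀ (L ++ [x₀]) 1 := by
  induction L with
  | nil => simp [crossings, crossing, ← one_eq_mk]
  | cons x L ih =>
    have h₁ := ih fun p hp => h p (hp.trans (List.suffix_cons x _))
    have h₂ : 0 ≤ crossing f x₀ x (f (mk (L ++ [x₀])) * 1) := by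
      unfold crossing
      split_ifs with h₃ h₄
      · simp
      · obtain ⟨rfl, h₄⟩ := h₄
        refine absurd ?_ (h (L ++ [x₀]) List.suffix_rfl)
        rwa [mul_one, ← _root_.map_mul, ← mk_cons] at h₄
      · simp
    simp only [crossings, List.cons_append]
    linarith

variable (n : ℕ)

open scoped Classical in
/-- The permutation of `Q × ℤ/n` given by the letter `x₀`, counting crossings. -/
noncomputable def edgePerm : Equiv.Perm (Q × ZMod n) where
  toFun p := (f (mk [x₀]) * p.1, p.2 + if p.1 = 1 then 1 else 0)
  invFun p := ((f (mk [x₀]))⁻¹ * p.1, p.2 - if (f (mk [x₀]))⁻¹ * p.1 = 1 then 1 else 0)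
  left_inv p := by simp
  right_inv p := by simp

open scoped Classical in
/-- The action of the free group on `Q × ℤ/n` counting crossings modulo `n`. -/
noncomputable def crossingHom : FreeGroup α →* Equiv.Perm (Q × ZMod n) :=
  lift fun j => if j = x₀.1 then (if x₀.2 then edgePerm f x₀ n else (edgePerm f x₀ n)⁻¹)
    else (Equiv.mulLeft (f (of j))).prodCongr (Equiv.refl _)

theorem crossingHom_letter (x : α × Bool) (a : Q) (s : ZMod n) :
    crossingHom f x₀ n (mk [x]) (a, s) = (f (mk [x]) * a, s + crossing f x₀ x a) := by
  classical
  obtain ⟨j, b⟩ := x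
  obtain ⟨i, c⟩ := x₀
  have e : ∀ y : α, mk [(y, false)] = (of y)⁻¹ := fun y => by simp [of, invRev]
  have e' : ∀ y : α, mk [(y, true)] = of y := fun y => rfl
  by_cases hji : j = i
  · subst hji
    cases b <;> cases c <;>
      simp [crossingHom, crossing, edgePerm, e, e', Equiv.Perm.inv_def, sub_eq_add_neg, apply_ite] <;>
      split_ifs <;> simp_all
  · cases b <;> simp [crossingHom, crossing, e, e', hji, Equiv.Perm.inv_def]

theorem crossingHom_mk (L : List (α × Bool)) (a : Q) (s : ZMod n) :
    crossingHom f x₀ n (mk L) (a, s) = (f (mk L) * a, s + crossings f x₀ L a) := by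
  induction L with
  | nil => simp [crossings, ← one_eq_mk]
  | cons x L ih =>
    rw [mk_cons, _root_.map_mul, Equiv.Perm.mul_apply, ih, crossingHom_letter, _root_.map_mul,
      mul_assoc, crossings]
    push_cast
    rw [add_assoc, add_comm (crossings f x₀ L a : ZMod n)]

theorem crossingHom_pow (L : List (α × Bool)) (k : ℕ) (a : Q) (s : ZMod n) :
    crossingHom f x₀ n (mk L ^ k) (a, s) = (f (mk L) ^ k * a,
      s + (∑ l ∈ Finset.range k, crossings f x₀ L (f (mk L) ^ l * a) : ℤ)) := by
  induction k with
  | zero => simp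
  | succ k ih =>
    rw [pow_succ', _root_.map_mul, Equiv.Perm.mul_apply, ih, crossingHom_mk, Finset.sum_range_succ,
      ← mul_assoc, ← pow_succ']
    push_cast
    rw [add_assoc]

open scoped Classical in
theorem crossingHom_translate (g : FreeGroup α) (a : Q) (s : ZMod n) :
    crossingHom f x₀ n g (a, s) = (f g * a, s + (crossingHom f x₀ n g (a, 0)).2) := by
  have := crossingHom_mk f x₀ n g.toWord
  rw [mk_toWord] at this
  simp [this]

end FreeGroup

/-! ### Density of centralizers in the completion -/

namespace FreeGroup

variable {α : Type*}

theorem IsCyclicallyReduced.isReduced_rotate {L₁ L₂ : List (α × Bool)}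
    (h : IsCyclicallyReduced (L₁ ++ L₂)) : IsReduced (L₂ ++ L₁) := by
  have h₁ := List.isChain_append.1 h.1
  refine List.isChain_append.2 ⟨h₁.2.1, h₁.1, fun x hx y hy => h.2 x ?_ y ?_⟩
  · rw [List.getLast?_append, hx]; simp
  · rw [List.head?_append, hy]; simp

/-- A suffix of a cyclically reduced word which commutes with it begins with the same letter. -/
theorem IsCyclicallyReduced.head?_eq_of_commute {L p : List (α × Bool)}
    (h : IsCyclicallyReduced L) (hp : p <:+ L) (hne : p ≠ []) (hc : Commute (mk p) (mk L)) :
    L.head? = p.head? := by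
  classical
  obtain ⟨L₁, rfl⟩ := hp
  -- Both sides are reduced, the left one being a rotation of a cyclically reduced word, so they
  -- agree letter by letter.
  have h₁ : mk (p ++ L₁) = mk (L₁ ++ p) := by
    have := hc.eq
    rw [← mul_mk, ← mul_assoc] at this
    simpa [mul_mk] using mul_right_cancel this
  have h₂ := congrArg toWord h₁
  rw [toWord_mk, toWord_mk, h.isReduced_rotate.reduce_eq, h.1.reduce_eq] at h₂
  rw [← h₂]
  cases p with
  | nil => exact absurd rfl hne
  | cons x p => rfl

/-- The closed path of a power of `w` through `1` has nonzero net crossing number over the edge at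
`1`. If `g` commutes with `w` in the action that records crossings modulo a large `n`, the path
translated by `g` also has nonzero crossing number, hence visits `1`. This visit writes `g`, modulo
`V₀`, through a suffix of `w` and a power of `w`, and the suffix commutes with `w`. -/
theorem exists_commute_of_isCyclicallyReduced {w : List (α × Bool)} (hw : IsCyclicallyReduced w)
    (V : FiniteIndexNormalSubgroup (FreeGroup α)) :
    ∃ V' ≤ V, ∀ g, ⁅g, mk w⁆ ∈ V' → ∃ s, Commute s (mk w) ∧ s⁻¹ * g ∈ V := by
  rcases List.eq_nil_or_concat' w with rfl | ⟨L, x₀, rfl⟩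
  · exact ⟨V, le_rfl, fun g _ => ⟨g, by simp [← one_eq_mk], by simp⟩⟩
  set w := L ++ [x₀] with hwdef
  set v := mk w with hv
  -- `V₀` is deep enough that a suffix of `w` commuting with `v` modulo `V₀` commutes with it
  -- exactly.
  obtain ⟨V₀, hV₀, hsep⟩ := Group.ResiduallyFinite.exists_le_forall_mem V
    (S := (fun p => ⁅mk p, v⁆) '' {p | p ∈ w.tails}) ((List.finite_toSet _).image _)
  have hsep' : ∀ p, p <:+ w → ⁅mk p, v⁆ ∈ V₀ → Commute (mk p) v := fun p hp h =>
    commutatorElement_eq_one_iff_commute.1 (hsep _ ⟨p, List.mem_tails p w |>.2 hp, rfl⟩ h)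
  let f := QuotientGroup.mk' V₀.toSubgroup
  have hf : ∀ g, f g = 1 ↔ g ∈ V₀ := fun g => QuotientGroup.eq_one_iff g
  -- No negative crossings: one would give a suffix commuting with `v` and beginning with `x₀⁻¹`.
  -- Then `w` would begin with `x₀⁻¹` and end with `x₀`, against cyclic reduction.
  have hpos : ∀ (l : ℕ) (p : List (α × Bool)), (x₀.1, !x₀.2) :: p <:+ w →
      f (mk ((x₀.1, !x₀.2) :: p)) * f v ^ l ≠ 1 := by
    intro l p hp h
    have h₁ : Commute (mk ((x₀.1, !x₀.2) :: p)) v := by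
      refine hsep' _ hp ?_
      rw [← hf, map_commutatorElement, commutatorElement_eq_one_iff_commute,
        eq_inv_of_mul_eq_one_left h]
      exact (Commute.pow_self _ _).inv_left
    have h₂ := hw.head?_eq_of_commute hp (by simp) h₁
    have h₃ := hw.2 x₀ (by simp [hwdef]) (x₀.1, !x₀.2) (by rw [h₂]; simp) rfl
    simp at h₃
  let q := orderOf (f v)
  have hq : 0 < q := orderOf_pos _
  let T : FreeGroup α ⧸ V₀.toSubgroup → ℤ := fun a =>
    ∑ l ∈ Finset.range q, crossings f x₀ w (f v ^ l * a)
  have hT₁ : 0 < T 1 := by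
    refine Finset.sum_pos' (fun l _ => crossings_nonneg f x₀ fun p hp => ?_)
      ⟨0, Finset.mem_range.2 hq, ?_⟩
    · rw [mul_one]
      exact hpos l p hp
    · rw [pow_zero, mul_one]
      refine crossings_pos f x₀ fun p hp => ?_
      simpa using hpos 0 p hp
  have hT₂ : T 1 ≤ q * w.length := by
    refine (Finset.sum_le_card_nsmul _ _ _ fun l _ => crossings_le_length f x₀ w _).trans ?_
    simp
  -- Larger than `T 1`, so that `T 1` is nonzero modulo `n`.
  let n := q * w.length + 1
  have : NeZero n := ⟨Nat.succ_ne_zero _⟩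
  refine ⟨V₀ ⊓ .ofSubgroup (crossingHom f x₀ n).ker, inf_le_left.trans hV₀, fun g hg => ?_⟩
  have hg₁ : ⁅g, v⁆ ∈ V₀ := hg.1
  have hg₂ : ⁅g, v⁆ ∈ (crossingHom f x₀ n).ker := hg.2
  rw [MonoidHom.mem_ker, map_commutatorElement, commutatorElement_eq_one_iff_commute] at hg₂
  have key := congrArg Prod.snd (DFunLike.congr_fun (hg₂.pow_right q).eq (1, 0))
  rw [← map_pow, Equiv.Perm.mul_apply, Equiv.Perm.mul_apply, crossingHom_pow,
    crossingHom_translate f x₀ n g 1, crossingHom_translate, crossingHom_pow,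
    pow_orderOf_eq_one, mul_one, mul_one] at key
  change (0 : ZMod n) + (T 1 : ℤ) + _ = _ + (T (f g) : ℤ) at key
  have hT : T (f g) ≠ 0 := by
    intro h
    rw [h, zero_add, zero_add, Int.cast_zero, add_zero, add_eq_right,
      ZMod.intCast_zmod_eq_zero_iff_dvd] at key
    have := Int.le_of_dvd hT₁ key
    push_cast [n] at this
    linarith
  obtain ⟨l, -, hl⟩ := Finset.exists_ne_zero_of_sum_ne_zero hT
  obtain ⟨p, hp, hpl⟩ := exists_suffix_of_crossings_ne_zero f x₀ hl
  have hpV : mk p * (v ^ l * g) ∈ V₀ := by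
    rw [← hf]
    simpa using hpl
  have hpc : Commute (mk p) v := by
    refine hsep' p hp ?_
    rw [← hf, map_commutatorElement, commutatorElement_eq_one_iff_commute,
      eq_inv_of_mul_eq_one_left hpl, ← map_pow, ← _root_.map_mul]
    refine Commute.inv_left ?_
    rw [_root_.map_mul, map_pow]
    refine ((Commute.refl (f v)).pow_left l).mul_left ?_
    rwa [← commutatorElement_eq_one_iff_commute, ← map_commutatorElement, hf]
  refine ⟨(mk p * v ^ l)⁻¹, (hpc.mul_left ((Commute.refl v).pow_left l)).inv_left, hV₀ ?_⟩
  rwa [inv_inv, mul_assoc]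

/-- Modulo deeper and deeper normal subgroups of finite index, an element that commutes with `v`
is approximated by elements of the centralizer of `v`. -/
theorem exists_commute_of_commutator_mem (v : FreeGroup α)
    (V : FiniteIndexNormalSubgroup (FreeGroup α)) :
    ∃ V' ≤ V, ∀ g, ⁅g, v⁆ ∈ V' → ∃ s, Commute s v ∧ s⁻¹ * g ∈ V := by
  classical
  obtain ⟨V', hV', h⟩ := exists_commute_of_isCyclicallyReduced
    (reduceCyclically.isCyclicallyReduced (isReduced_toWord (x := v))) V
  set w := reduceCyclically v.toWord
  set c := mk (reduceCyclically.conjugator v.toWord)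
  have hv : v = c * mk w * c⁻¹ := by
    conv_lhs => rw [← mk_toWord (x := v),
      ← reduceCyclically.conj_conjugator_reduceCyclically v.toWord]
    rw [← mul_mk, ← mul_mk, ← inv_mk]
  have hw : mk w = MulAut.conj c⁻¹ v := by rw [hv]; simp [mul_assoc]
  refine ⟨V', hV', fun g hg => ?_⟩
  obtain ⟨s, hs, hsg⟩ := h (MulAut.conj c⁻¹ g) (by
    rw [hw, ← map_commutatorElement, MulAut.conj_apply]
    exact V'.isNormal'.conj_mem _ hg _)
  refine ⟨MulAut.conj c s, ?_, ?_⟩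
  · have := hs.map (MulAut.conj c)
    rwa [hw, ← MulAut.mul_apply, ← _root_.map_mul, mul_inv_cancel, _root_.map_one,
      MulAut.one_apply] at this
  · have := V.isNormal'.conj_mem _ hsg c
    simpa [mul_assoc, FiniteIndexNormalSubgroup.mem_toSubgroup_iff] using this

end FreeGroup

/-! ### Commuting elements and exponent sums -/

namespace FreeGroup

variable {α : Type*}

theorem eq_of_commute_of {i j : α} (h : Commute (of i) (of j)) : i = j := by
  classical
  have h₁ : mk [(i, true), (j, true)] = mk [(j, true), (i, true)] := h.eq
  have h₂ := congrArg toWord h₁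
  have hr : ∀ i j : α, IsReduced [(i, true), (j, true)] := fun i j => by simp
  rw [toWord_mk, toWord_mk, (hr i j).reduce_eq, (hr j i).reduce_eq] at h₂
  simp at h₂
  exact h₂.1

theorem isCyclic_of_subsingleton [Subsingleton α] : IsCyclic (FreeGroup α) := by
  rcases isEmpty_or_nonempty α with h | ⟨⟨i⟩⟩
  · infer_instance
  · have : Unique α := { default := i, uniq := fun _ => Subsingleton.elim _ _ }
    infer_instance

end FreeGroup

namespace IsFreeGroup

/-- A commutative free group is cyclic. -/
theorem isCyclic_of_commute {G : Type*} [Group G] [IsFreeGroup G] (h : ∀ a b : G, Commute a b) :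
    IsCyclic G := by
  have : Subsingleton (Generators G) := ⟨fun i j => FreeGroup.eq_of_commute_of <| by
    have := (h (mulEquiv G (.of i)) (mulEquiv G (.of j))).map (mulEquiv G).symm
    simpa using this⟩
  have := FreeGroup.isCyclic_of_subsingleton (α := Generators G)
  exact (mulEquiv G).isCyclic.1 this

/-- By Nielsen–Schreier the subgroup generated by `a` and `b` is free; being commutative, it is
cyclic. -/
theorem exists_mem_zpowers_of_commute {G : Type*} [Group G] [IsFreeGroup G] {a b : G}
    (h : Commute a b) : ∃ c, a ∈ Subgroup.zpowers c ∧ b ∈ Subgroup.zpowers c := by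
  let A := Subgroup.closure {a, b}
  have hA : ∀ x y : A, Commute x y := fun x y => by
    have hle : A ≤ Subgroup.centralizer (A : Set G) := by
      rw [Subgroup.centralizer_closure, Subgroup.closure_le]
      rintro x (rfl | rfl) <;> rw [SetLike.mem_coe, Subgroup.mem_centralizer_iff] <;>
        rintro y (rfl | rfl) <;> first | rfl | exact h.eq | exact h.eq.symm
    exact Subtype.ext (hle y.2 x x.2)
  obtain ⟨c, hc⟩ := (isCyclic_of_commute hA).exists_generator
  refine ⟨c, ?_, ?_⟩
  · obtain ⟨k, hk⟩ := hc ⟨a, Subgroup.subset_closure (by simp)⟩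
    exact ⟨k, congrArg Subtype.val hk⟩
  · obtain ⟨k, hk⟩ := hc ⟨b, Subgroup.subset_closure (by simp)⟩
    exact ⟨k, congrArg Subtype.val hk⟩

end IsFreeGroup

namespace FreeGroup

variable {α : Type*}

open scoped Classical in
/-- The exponent sum of a generator. -/
noncomputable def exponentSum (i : α) : FreeGroup α →* Multiplicative ℤ :=
  lift fun j => if j = i then Multiplicative.ofAdd 1 else 1

theorem exponentSum_of_self (i : α) : exponentSum i (of i) = Multiplicative.ofAdd 1 := by
  simp [exponentSum]

theorem exponentSum_of_ne {i j : α} (h : j ≠ i) : exponentSum i (of j) = 1 := by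
  simp [exponentSum, h]

/-- If `c ^ k = of i`, the exponent sum of `i` forces `k = ±1`, so the common root `c` is `of i` up
to inversion. -/
theorem mem_zpowers_of_commute_of {v : FreeGroup α} {i : α} (h : Commute v (of i)) :
    v ∈ Subgroup.zpowers (of i) := by
  obtain ⟨c, hv, k, hk⟩ := IsFreeGroup.exists_mem_zpowers_of_commute h
  have h₁ := congrArg (fun g => Multiplicative.toAdd (exponentSum i g)) hk
  simp only [map_zpow, exponentSum_of_self, toAdd_zpow, toAdd_ofAdd, smul_eq_mul] at h₁
  rcases Int.eq_one_or_neg_one_of_mul_eq_one h₁ with rfl | rfl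
  · simpa [← hk] using hv
  · simpa [← hk] using hv

theorem subsingleton_of_central {v : FreeGroup α} (hv : v ≠ 1) (h : ∀ g, Commute v g) :
    Subsingleton α := by
  refine ⟨fun i j => by_contra fun hij => hv ?_⟩
  obtain ⟨a, ha⟩ := mem_zpowers_of_commute_of (h (of i))
  obtain ⟨b, hb⟩ := mem_zpowers_of_commute_of (h (of j))
  have h₁ := congrArg (fun g => Multiplicative.toAdd (exponentSum i g)) (ha.trans hb.symm)
  simp [exponentSum_of_self, exponentSum_of_ne (Ne.symm hij)] at h₁
  rw [← ha, h₁]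
  simp

end FreeGroup

namespace IsFreeGroup

variable {G : Type*} [Group G] [IsFreeGroup G]

/-- A free group with a nontrivial central element is cyclic. -/
theorem isCyclic_of_central {v : G} (hv : v ≠ 1) (h : ∀ g, Commute v g) : IsCyclic G := by
  have : Subsingleton (Generators G) := FreeGroup.subsingleton_of_central
    (v := (mulEquiv G).symm v) (by simpa using hv) fun g => by
      simpa using (h (mulEquiv G g)).map (mulEquiv G).symm
  have := FreeGroup.isCyclic_of_subsingleton (α := Generators G)
  exact (mulEquiv G).isCyclic.1 this

/-- Centralizers of nontrivial elements of a free group are cyclic. -/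
theorem exists_forall_commute_mem_zpowers {v : G} (hv : v ≠ 1) :
    ∃ c, ∀ s, Commute s v → s ∈ Subgroup.zpowers c := by
  let C := Subgroup.centralizer {v}
  have hC : ∀ s, s ∈ C ↔ Commute s v := fun s => by
    rw [Subgroup.mem_centralizer_singleton_iff]; rfl
  obtain ⟨c, hc⟩ := (isCyclic_of_central (G := C) (v := ⟨v, (hC v).2 (Commute.refl v)⟩)
    (fun h => hv (congrArg Subtype.val h))
    (fun g => Subtype.ext ((hC _).1 g.2).eq.symm)).exists_generator
  refine ⟨c, fun s hs => ?_⟩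
  obtain ⟨k, hk⟩ := hc ⟨s, (hC s).2 hs⟩
  exact ⟨k, congrArg Subtype.val hk⟩

/-! ### Torsion and roots in the completion of a free group -/

/-- Free groups are projective: the homomorphism of the preimage of a cyclic subgroup
`⟨g⟩` of a quotient to `⟨g⟩` lifts to the integers. -/
theorem exists_hom_int (V : Subgroup G) [V.Normal] (g : G) :
    ∃ χ : (Subgroup.zpowers (QuotientGroup.mk' V g)).comap (QuotientGroup.mk' V) →*
      Multiplicative ℤ, ∀ h : (Subgroup.zpowers (QuotientGroup.mk' V g)).comap
        (QuotientGroup.mk' V), QuotientGroup.mk' V (h : G) =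
          QuotientGroup.mk' V g ^ Multiplicative.toAdd (χ h) := by
  set H := (Subgroup.zpowers (QuotientGroup.mk' V g)).comap (QuotientGroup.mk' V)
  have : ∀ h : H, ∃ k : ℤ, QuotientGroup.mk' V g ^ k = QuotientGroup.mk' V h := fun h => h.2
  choose k hk using this
  -- `k` is only determined modulo the order of the class of `g`, so it need not be multiplicative;
  -- only its values on a basis of the free group `H` are used.
  let χ : H →* Multiplicative ℤ := lift fun i => Multiplicative.ofAdd (k (of i))
  have : (QuotientGroup.mk' V).comp H.subtype =
      (zpowersHom _ (QuotientGroup.mk' V g)).comp χ := by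
    refine ext_hom fun a => ?_
    simp only [MonoidHom.comp_apply, χ, lift_of, zpowersHom_apply, toAdd_ofAdd, hk]
    rfl
  exact ⟨χ, fun h => DFunLike.congr_fun this h⟩

end IsFreeGroup

/-- A homomorphism to the integers of a subgroup of finite index, taken modulo `n`, is trivial on
a normal subgroup of finite index of the whole group. -/
theorem Subgroup.exists_finiteIndexNormalSubgroup_dvd {G : Type*} [Group G] (H : Subgroup G)
    [H.FiniteIndex] (χ : H →* Multiplicative ℤ) {n : ℕ} (hn : n ≠ 0) :
    ∃ U : FiniteIndexNormalSubgroup G, ∀ h : H, (h : G) ∈ U →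
      (n : ℤ) ∣ Multiplicative.toAdd (χ h) := by
  have : NeZero n := ⟨hn⟩
  let ψ : H →* Multiplicative (ZMod n) :=
    (AddMonoidHom.toMultiplicative (Int.castAddHom (ZMod n))).comp χ
  have : (ψ.ker.map H.subtype).FiniteIndex := by
    constructor
    rw [Subgroup.index_map_subtype]
    exact mul_ne_zero Subgroup.FiniteIndex.index_ne_zero Subgroup.FiniteIndex.index_ne_zero
  refine ⟨.ofSubgroup (ψ.ker.map H.subtype).normalCore, fun h hh => ?_⟩
  obtain ⟨h', h₁, h₂⟩ := Subgroup.normalCore_le _ hh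
  obtain rfl : h' = h := Subtype.ext h₂
  rw [← ZMod.intCast_zmod_eq_zero_iff_dvd]
  exact h₁

theorem FiniteIndexNormalSubgroup.exists_le_forall_le {G ι : Type*} [Group G] [Finite ι]
    (V : FiniteIndexNormalSubgroup G) (U : ι → FiniteIndexNormalSubgroup G) :
    ∃ W ≤ V, ∀ i, W ≤ U i := by
  classical
  cases nonempty_fintype ι
  have : ∀ s : Finset ι, ∃ W ≤ V, ∀ i ∈ s, W ≤ U i := fun s => by
    induction s using Finset.induction_on with
    | empty => exact ⟨V, le_rfl, by simp⟩
    | insert a s _ ih =>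
      obtain ⟨W, hW, h⟩ := ih
      refine ⟨W ⊓ U a, inf_le_left.trans hW, fun i hi => ?_⟩
      rcases Finset.mem_insert.1 hi with rfl | hi
      exacts [inf_le_right, inf_le_left.trans (h i hi)]
  obtain ⟨W, hW, h⟩ := this Finset.univ
  exact ⟨W, hW, fun i => h i (Finset.mem_univ i)⟩

namespace IsFreeGroup

variable {G : Type*} [Group G] [IsFreeGroup G]

instance finiteIndex_comap_mk' (V : FiniteIndexNormalSubgroup G) (K : Subgroup (G ⧸ V.toSubgroup)) :
    (K.comap (QuotientGroup.mk' V.toSubgroup)).FiniteIndex := by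
  refine Subgroup.finiteIndex_of_le (H := V.toSubgroup) fun g hg => ?_
  rw [Subgroup.mem_comap, QuotientGroup.mk'_apply, (QuotientGroup.eq_one_iff g).2 hg]
  exact one_mem K

instance residuallyFinite : Group.ResiduallyFinite G := by
  refine Group.residuallyFinite_iff_exists_finiteIndexNormalSubgroup.2 fun g hg => ?_
  obtain ⟨V, hV⟩ := Group.exists_finiteIndexNormalSubgroup_notMem ((mulEquiv G).symm g)
    (by simpa using hg)
  exact ⟨V.comap (mulEquiv G).symm.toMonoidHom, hV⟩

/-- The order of a nontrivial element of a free group in finite quotients is arbitrarily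
divisible. -/
theorem exists_forall_zpow_mem_dvd {c : G} (hc : c ≠ 1) {M : ℕ} (hM : M ≠ 0) :
    ∃ U : FiniteIndexNormalSubgroup G, ∀ l : ℤ, c ^ l ∈ U → (M : ℤ) ∣ l := by
  obtain ⟨V, hV⟩ := Group.exists_finiteIndexNormalSubgroup_notMem c hc
  obtain ⟨χ, hχ⟩ := exists_hom_int V.toSubgroup c
  let C : (Subgroup.zpowers (QuotientGroup.mk' V.toSubgroup c)).comap
    (QuotientGroup.mk' V.toSubgroup) := ⟨c, Subgroup.mem_zpowers _⟩
  set a := Multiplicative.toAdd (χ C) with ha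
  have ha₀ : a ≠ 0 := by
    intro h
    have := hχ C
    rw [← ha, h, zpow_zero] at this
    exact hV ((QuotientGroup.eq_one_iff c).1 this)
  obtain ⟨U, hU⟩ := Subgroup.exists_finiteIndexNormalSubgroup_dvd _ χ
    (n := a.natAbs * M) (by simp [ha₀, hM])
  refine ⟨U, fun l hl => ?_⟩
  have := hU (C ^ l) hl
  rw [map_zpow, toAdd_zpow, ← ha, smul_eq_mul, mul_comm l, Nat.cast_mul, Int.natCast_natAbs] at this
  exact (mul_dvd_mul_iff_left ha₀).1 ((mul_dvd_mul_right (self_dvd_abs a) _).trans this)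

/-- The profinite completion of a free group is torsion-free. -/
theorem exists_forall_pow_mem {m : ℕ} (hm : m ≠ 0) (V : FiniteIndexNormalSubgroup G) :
    ∃ V' ≤ V, ∀ g, g ^ m ∈ V' → g ∈ V := by
  have : ∀ x : G ⧸ V.toSubgroup, ∃ U : FiniteIndexNormalSubgroup G,
      ∀ g, QuotientGroup.mk' V.toSubgroup g = x → g ^ m ∈ U → g ∈ V := by
    intro x
    obtain ⟨g₀, rfl⟩ := QuotientGroup.mk'_surjective _ x
    obtain ⟨χ, hχ⟩ := exists_hom_int V.toSubgroup g₀
    obtain ⟨U, hU⟩ := Subgroup.exists_finiteIndexNormalSubgroup_dvd _ χ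
      -- The factor `m` cancels against the exponent of `g ^ m`; the order then kills the class of
      -- `g`.
      (n := m * orderOf (QuotientGroup.mk' V.toSubgroup g₀)) (mul_ne_zero hm (orderOf_pos _).ne')
    refine ⟨U, fun g hg hgU => ?_⟩
    have hgH : g ∈ (Subgroup.zpowers (QuotientGroup.mk' V.toSubgroup g₀)).comap
        (QuotientGroup.mk' V.toSubgroup) := by
      rw [Subgroup.mem_comap, hg]
      exact Subgroup.mem_zpowers _
    have h₁ := hU (⟨g, hgH⟩ ^ m) hgU
    rw [map_pow, toAdd_pow, nsmul_eq_mul, Nat.cast_mul,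
      mul_dvd_mul_iff_left (by exact_mod_cast hm)] at h₁
    have h₂ := hχ ⟨g, hgH⟩
    rw [orderOf_dvd_iff_zpow_eq_one.1 h₁] at h₂
    exact (QuotientGroup.eq_one_iff g).1 h₂
  choose U hU using this
  obtain ⟨W, hW, h⟩ := FiniteIndexNormalSubgroup.exists_le_forall_le V U
  exact ⟨W, hW, fun g hg => hU _ g rfl (h _ hg)⟩

theorem exists_commute_of_commutator_mem (v : G) (V : FiniteIndexNormalSubgroup G) :
    ∃ V' ≤ V, ∀ g, ⁅g, v⁆ ∈ V' → ∃ s, Commute s v ∧ s⁻¹ * g ∈ V := by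
  obtain ⟨V', -, h⟩ := FreeGroup.exists_commute_of_commutator_mem ((mulEquiv G).symm v)
    (V.comap (mulEquiv G).toMonoidHom)
  refine ⟨V ⊓ V'.comap (mulEquiv G).symm.toMonoidHom, inf_le_left, fun g hg => ?_⟩
  obtain ⟨s, hs, hsV⟩ := h ((mulEquiv G).symm g) (by
    rw [← map_commutatorElement]
    exact hg.2)
  refine ⟨mulEquiv G s, by simpa using hs.map (mulEquiv G), ?_⟩
  have : mulEquiv G (s⁻¹ * (mulEquiv G).symm g) ∈ V := hsV
  simpa using this

/-- Roots in the profinite completion of an element of a free group belong to the free group. -/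
theorem exists_forall_inv_mul_mem (v : G) {m : ℕ} (hm : m ≠ 0) :
    ∃ f : G, ∀ V : FiniteIndexNormalSubgroup G, ∃ V' ≤ V, ∀ g, v⁻¹ * g ^ m ∈ V' → f⁻¹ * g ∈ V := by
  by_cases hv : v = 1
  · refine ⟨1, fun V => ?_⟩
    simpa [hv] using exists_forall_pow_mem hm V
  obtain ⟨c, hc⟩ := exists_forall_commute_mem_zpowers hv
  obtain ⟨k, hk⟩ := hc v (Commute.refl v)
  have hk : c ^ k = v := hk
  have hc₁ : c ≠ 1 := by
    rintro rfl
    exact hv (by rw [← hk, one_zpow])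
  -- The division is exact as soon as some `g` satisfies the hypothesis, by `hkm`; otherwise the
  -- witness is irrelevant.
  refine ⟨c ^ (k / m), fun V => ?_⟩
  obtain ⟨U, hU⟩ := exists_forall_zpow_mem_dvd hc₁ (M := m * V.toSubgroup.index)
    (mul_ne_zero hm Subgroup.FiniteIndex.index_ne_zero)
  obtain ⟨V', hV', h⟩ := exists_commute_of_commutator_mem v (V ⊓ U)
  refine ⟨V', hV'.trans inf_le_left, fun g hg => ?_⟩
  let π' := QuotientGroup.mk' V'.toSubgroup
  let π := QuotientGroup.mk' (V ⊓ U).toSubgroup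
  have hπ' : ∀ x, π' x = 1 ↔ x ∈ V' := fun x => QuotientGroup.eq_one_iff x
  have hπ : ∀ x, π x = 1 ↔ x ∈ V ⊓ U := fun x => QuotientGroup.eq_one_iff x
  obtain ⟨s, hs, hsg⟩ := h g (by
    rw [← hπ', map_commutatorElement, commutatorElement_eq_one_iff_commute]
    rw [← hπ', _root_.map_mul, map_inv, inv_mul_eq_one] at hg
    rw [hg, map_pow]
    exact Commute.self_pow _ _)
  obtain ⟨l, rfl⟩ := hc s hs
  replace hg := hV' hg
  have hl : c ^ (m * l - k) ∈ V ⊓ U := by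
    rw [← hπ, _root_.map_mul, map_inv, inv_mul_eq_one] at hsg hg
    rw [← hπ, zpow_sub, hk, _root_.map_mul, map_inv, mul_inv_eq_one, hg, map_pow, ← hsg,
      mul_comm, zpow_mul]
    simp
  obtain ⟨d, hd⟩ := hU _ hl.2
  have hkm : k = m * (l - V.toSubgroup.index * d) := by
    push_cast at hd
    linarith
  have hm' : (m : ℤ) ≠ 0 := by exact_mod_cast hm
  rw [hkm, Int.mul_ediv_cancel_left _ hm']
  have h₁ : c ^ ((V.toSubgroup.index : ℤ) * d) ∈ V := by
    rw [zpow_mul, zpow_natCast]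
    exact zpow_mem (Subgroup.pow_index_mem V.toSubgroup c) d
  have h₂ : (c ^ (l - (V.toSubgroup.index : ℤ) * d))⁻¹ * g =
      c ^ ((V.toSubgroup.index : ℤ) * d) * ((c ^ l)⁻¹ * g) := by
    rw [zpow_sub]; group
  rw [h₂]
  exact mul_mem h₁ hsg.1

end IsFreeGroup

/-! ### Centres of completions of free and virtually free groups -/

/-- A central element is approximated both by powers of `of i` and by powers of `of j`; comparing
exponent sums of `i` shows that the powers of `of i` can be taken in `V`. -/
theorem FreeGroup.exists_forall_commutator_mem {α : Type*} {i j : α} (hij : i ≠ j)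
    (V : FiniteIndexNormalSubgroup (FreeGroup α)) :
    ∃ V' : FiniteIndexNormalSubgroup (FreeGroup α), ∀ g, (∀ h, ⁅g, h⁆ ∈ V') → g ∈ V := by
  obtain ⟨U, hU⟩ := Subgroup.exists_finiteIndexNormalSubgroup_dvd (⊤ : Subgroup (FreeGroup α))
    ((exponentSum i).comp (Subgroup.subtype _)) (n := V.toSubgroup.index)
    Subgroup.FiniteIndex.index_ne_zero
  obtain ⟨V₁, -, h₁⟩ := exists_commute_of_commutator_mem (of i) (V ⊓ U)
  obtain ⟨V₂, -, h₂⟩ := exists_commute_of_commutator_mem (of j) (V ⊓ U)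
  refine ⟨V₁ ⊓ V₂, fun g hg => ?_⟩
  obtain ⟨s, hs, hsg⟩ := h₁ g (hg _).1
  obtain ⟨t, ht, htg⟩ := h₂ g (hg _).2
  obtain ⟨a, rfl⟩ := mem_zpowers_of_commute_of hs
  obtain ⟨b, rfl⟩ := mem_zpowers_of_commute_of ht
  have hab : (of i ^ a)⁻¹ * of j ^ b ∈ U := by
    have h₃ : (of i ^ a)⁻¹ * g ∈ U := hsg.2
    have h₄ : (of j ^ b)⁻¹ * g ∈ U := htg.2
    have := mul_mem h₃ (inv_mem h₄)
    simpa using this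
  have ha := hU ⟨_, Subgroup.mem_top _⟩ hab
  simp only [MonoidHom.comp_apply, Subgroup.subtype_apply, _root_.map_mul, _root_.map_inv, map_zpow,
    exponentSum_of_self, exponentSum_of_ne (Ne.symm hij), one_zpow, mul_one, toAdd_inv, toAdd_zpow,
    toAdd_ofAdd, smul_eq_mul, dvd_neg] at ha
  obtain ⟨d, rfl⟩ := ha
  have h₃ : of i ^ ((V.toSubgroup.index : ℤ) * d) ∈ V := by
    rw [zpow_mul, zpow_natCast]
    exact zpow_mem (Subgroup.pow_index_mem V.toSubgroup (of i)) d
  simpa using mul_mem h₃ hsg.1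

namespace Subgroup

variable {E : Type*} [Group E] (F : Subgroup E) [F.FiniteIndex]

theorem exists_finiteIndexNormalSubgroup_forall_mem (V : FiniteIndexNormalSubgroup F) :
    ∃ W : FiniteIndexNormalSubgroup E, ∀ f : F, (f : E) ∈ W → f ∈ V := by
  have : (V.toSubgroup.map F.subtype).FiniteIndex := by
    constructor
    rw [index_map_subtype]
    exact mul_ne_zero FiniteIndex.index_ne_zero FiniteIndex.index_ne_zero
  refine ⟨.ofSubgroup (V.toSubgroup.map F.subtype).normalCore, fun f hf => ?_⟩
  obtain ⟨f', h₁, h₂⟩ := normalCore_le _ hf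
  obtain rfl : f' = f := Subtype.ext h₂
  exact h₁

theorem residuallyFinite_of_finiteIndex [Group.ResiduallyFinite F] : Group.ResiduallyFinite E := by
  refine Group.residuallyFinite_iff_exists_finiteIndex.2 fun e he => ?_
  by_cases heF : e ∈ F
  · obtain ⟨V, hV⟩ := Group.exists_finiteIndexNormalSubgroup_notMem (⟨e, heF⟩ : F)
      (fun h => he (congrArg Subtype.val h))
    obtain ⟨W, hW⟩ := F.exists_finiteIndexNormalSubgroup_forall_mem V
    exact ⟨W.toSubgroup, inferInstance, fun h => hV (hW _ h)⟩
  · exact ⟨F, inferInstance, heF⟩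

variable [F.Normal] [IsFreeGroup F]

/-- In rank at least two, commutators within `F` suffice. If `F = ⟨x⟩` with `x ≠ 1`, some `y`
conjugates `x` to `x ^ b` with `b ≠ 1`, and `⁅x ^ a, y⁆ = x ^ ((1 - b) * a)` controls `a`. -/
theorem exists_forall_commutator_mem_of_isFreeGroup
    (hE : ∀ e : E, (∀ y, Commute e y) → e = 1) (V : FiniteIndexNormalSubgroup F) :
    ∃ W : FiniteIndexNormalSubgroup E, ∀ f : F, (∀ y : E, ⁅(f : E), y⁆ ∈ W) → f ∈ V := by
  rcases subsingleton_or_nontrivial (IsFreeGroup.Generators F) with h | ⟨i, j, hij⟩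
  · have := FreeGroup.isCyclic_of_subsingleton (α := IsFreeGroup.Generators F)
    have : IsCyclic F := (IsFreeGroup.mulEquiv F).isCyclic.1 this
    obtain ⟨x, hx⟩ := this.exists_generator
    by_cases hx₁ : x = 1
    · refine ⟨.ofSubgroup ⊤, fun f _ => ?_⟩
      obtain ⟨a, rfl⟩ := hx f
      simp [hx₁]
    obtain ⟨y, hy⟩ : ∃ y, ¬ Commute (x : E) y := by
      by_contra! h
      exact hx₁ (Subtype.ext (hE x h))
    obtain ⟨b, hb⟩ := hx (MulAut.conjNormal y x)
    have hb : x ^ b = MulAut.conjNormal y x := hb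
    have hb₁ : 1 - b ≠ 0 := by
      intro h
      obtain rfl : b = 1 := by omega
      refine hy (Commute.symm ?_)
      rw [zpow_one] at hb
      have := congrArg Subtype.val hb
      rw [MulAut.conjNormal_apply, eq_mul_inv_iff_mul_eq] at this
      exact this.symm
    obtain ⟨U, hU⟩ := IsFreeGroup.exists_forall_zpow_mem_dvd hx₁
      (M := (1 - b).natAbs * V.toSubgroup.index)
      (mul_ne_zero (by omega) FiniteIndex.index_ne_zero)
    obtain ⟨W, hW⟩ := F.exists_finiteIndexNormalSubgroup_forall_mem U
    refine ⟨W, fun f hf => ?_⟩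
    obtain ⟨a, rfl⟩ := hx f
    have h₁ : ((x ^ ((1 - b) * a) : F) : E) = ⁅((x ^ a : F) : E), y⁆ := by
      have : x ^ ((1 - b) * a) = x ^ a * (MulAut.conjNormal y (x ^ a))⁻¹ := by
        rw [map_zpow, ← hb, ← zpow_mul, ← zpow_neg, ← zpow_add]
        ring_nf
      rw [this, commutatorElement_def]
      rw [coe_mul, coe_inv, MulAut.conjNormal_apply]
      group
    have h₂ := hU _ (hW _ (h₁ ▸ hf y))
    rw [Nat.cast_mul, Int.natCast_natAbs] at h₂
    obtain ⟨d, rfl⟩ := (mul_dvd_mul_iff_left hb₁).1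
      ((mul_dvd_mul_right (self_dvd_abs _) _).trans h₂)
    change x ^ _ ∈ V
    rw [zpow_mul, zpow_natCast]
    exact zpow_mem (pow_index_mem V.toSubgroup x) d
  · obtain ⟨V', hV'⟩ := FreeGroup.exists_forall_commutator_mem hij
      (V.comap (IsFreeGroup.mulEquiv F).toMonoidHom)
    obtain ⟨W, hW⟩ := F.exists_finiteIndexNormalSubgroup_forall_mem
      (V'.comap (IsFreeGroup.mulEquiv F).symm.toMonoidHom)
    refine ⟨W, fun f hf => ?_⟩
    have : IsFreeGroup.mulEquiv F ((IsFreeGroup.mulEquiv F).symm f) ∈ V := hV' _ fun h => by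
      have := hW ⁅f, IsFreeGroup.mulEquiv F h⁆ (hf _)
      have : (IsFreeGroup.mulEquiv F).symm ⁅f, IsFreeGroup.mulEquiv F h⁆ ∈ V' := this
      simpa [map_commutatorElement] using this
    simpa using this

end Subgroup

/-- The profinite completion of a virtually free group with trivial centre has trivial centre:
an element which is central modulo a sufficiently deep normal subgroup of finite index is close to
the identity. -/
theorem Subgroup.exists_le_forall_commutator_mem_of_isFreeGroup {E : Type*} [Group E]
    (F : Subgroup E) [F.FiniteIndex] [F.Normal] [IsFreeGroup F]
    (hE : ∀ e : E, (∀ y, Commute e y) → e = 1) (W₀ : FiniteIndexNormalSubgroup E) :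
    ∃ W ≤ W₀, ∀ e, (∀ y, ⁅e, y⁆ ∈ W) → e ∈ W₀ := by
  have : Group.ResiduallyFinite E := F.residuallyFinite_of_finiteIndex
  set m := F.index with hm
  have hm₀ : m ≠ 0 := FiniteIndex.index_ne_zero
  have hroot : ∀ e : E, ∃ f : F, ∀ V : FiniteIndexNormalSubgroup F, ∃ V' ≤ V, ∀ g : F,
      (⟨e ^ m, F.pow_index_mem e⟩ : F) * g ^ m ∈ V' → f⁻¹ * g ∈ V := fun e => by
    simpa using IsFreeGroup.exists_forall_inv_mul_mem (⟨e ^ m, F.pow_index_mem e⟩ : F)⁻¹ hm₀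
  choose f hf using hroot
  have hcomm : ∀ e : E, ∃ y : E, ⁅e, y⁆ = 1 → e = 1 := fun e => by
    by_contra! h
    exact (h 1).2 (hE e fun y => commutatorElement_eq_one_iff_commute.1 (h y).1)
  choose y hy using hcomm
  -- `r x` is the only candidate in the coset `x` for a central element of the completion. There are
  -- finitely many, so `W₁` can detect each nontrivial commutator with a chosen witness `y`.
  let r : E ⧸ F → E := fun x => x.out * f x.out
  obtain ⟨W₁, hW₁, hsep⟩ := Group.ResiduallyFinite.exists_le_forall_mem W₀
    (Set.finite_range fun x => ⁅r x, y (r x)⁆)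
  let V₁ := W₁.comap F.subtype
  choose V' hV' hV'f using fun x : E ⧸ F => hf x.out V₁
  obtain ⟨V₂, -, hV₂⟩ := V₁.exists_le_forall_le V'
  obtain ⟨W₂, hW₂⟩ := F.exists_forall_commutator_mem_of_isFreeGroup hE V₂
  obtain ⟨W₃, hW₃⟩ := F.exists_finiteIndexNormalSubgroup_forall_mem V₂
  refine ⟨W₁ ⊓ (W₂ ⊓ W₃), inf_le_left.trans hW₁, fun e he => ?_⟩
  set W := W₁ ⊓ (W₂ ⊓ W₃)
  let π := QuotientGroup.mk' W.toSubgroup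
  have hπ : ∀ x, π x = 1 ↔ x ∈ W := fun x => QuotientGroup.eq_one_iff x
  have hπe : ∀ z, Commute (π e) (π z) := fun z => by
    rw [← commutatorElement_eq_one_iff_commute, ← map_commutatorElement, hπ]
    exact he z
  let x : E ⧸ F := e
  let g : F := ⟨x.out⁻¹ * e, by rw [← QuotientGroup.eq, QuotientGroup.out_eq']⟩
  let h : F := ⟨e ^ m, F.pow_index_mem e⟩
  have hh : h ∈ V₂ := hW₂ h fun z => by
    have : ⁅e ^ m, z⁆ ∈ W := by
      rw [← hπ, map_commutatorElement, commutatorElement_eq_one_iff_commute, map_pow]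
      exact (hπe z).pow_left m
    exact this.2.1
  -- Modulo `W`, `e` commutes with `x.out`, so the `m`-th power of `x.out⁻¹ * e` splits.
  have hgm : (⟨x.out ^ m, F.pow_index_mem _⟩ : F) * g ^ m * h⁻¹ ∈ V₂ := hW₃ _ (by
    have : x.out ^ m * (x.out⁻¹ * e) ^ m * (e ^ m)⁻¹ ∈ W := by
      rw [← hπ]
      simp only [_root_.map_mul, map_pow, map_inv]
      rw [((hπe x.out).symm.inv_left).mul_pow]
      simp
    exact this.2.2)
  have h₁ : (f x.out)⁻¹ * g ∈ V₁ := hV'f x g (hV₂ x (by simpa using mul_mem hgm hh))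
  have h₂ : (r x)⁻¹ * e ∈ W₁ := by
    have : ((f x.out : E))⁻¹ * (x.out⁻¹ * e) ∈ W₁ := h₁
    simpa [r, mul_assoc] using this
  let π₁ := QuotientGroup.mk' W₁.toSubgroup
  have hπ₁ : ∀ x, π₁ x = 1 ↔ x ∈ W₁ := fun x => QuotientGroup.eq_one_iff x
  -- As `e` and `r x` agree modulo `W₁`, `r x` commutes with its witness modulo `W₁`, hence exactly.
  have h₃ : r x = 1 := hy _ (hsep _ ⟨x, rfl⟩ (by
    rw [← hπ₁, _root_.map_mul, map_inv, inv_mul_eq_one] at h₂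
    rw [← hπ₁, map_commutatorElement, h₂, ← map_commutatorElement, hπ₁]
    exact (he _).1))
  rw [h₃, inv_one, one_mul] at h₂
  exact hW₁ h₂

/-! ### Completions of quotients, and their centres -/

namespace ProfiniteHat

variable {G : Type} [Group G]

theorem denseRange_toHat : DenseRange (toHat G) :=
  ProfiniteGrp.ProfiniteCompletion.denseRange (GrpCat.of G)

/-- The projection of the profinite completion to a finite quotient. -/
def proj (V : FiniteIndexNormalSubgroup G) : ProfiniteHat G →* G ⧸ V.toSubgroup where
  toFun z := z.1 V
  map_one' := rfl
  map_mul' _ _ := rfl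

theorem proj_toHat (V : FiniteIndexNormalSubgroup G) (g : G) : proj V (toHat G g) = g := rfl

theorem ext_proj {z z' : ProfiniteHat G} (h : ∀ V, proj V z = proj V z') : z = z' :=
  Subtype.ext (funext h)

theorem isOpen_ker_proj (V : FiniteIndexNormalSubgroup G) :
    IsOpen ((proj V).ker : Set (ProfiniteHat G)) := by
  let _ : TopologicalSpace (G ⧸ V.toSubgroup) := ⊥
  have : DiscreteTopology (G ⧸ V.toSubgroup) := ⟨rfl⟩
  have : Continuous (proj V) :=
    ((ProfiniteGrp.limitCone (ProfiniteGrp.ProfiniteCompletion.diagram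
      (GrpCat.of G))).π.app V).hom.continuous_toFun
  exact (isOpen_discrete {1}).preimage this

theorem exists_inv_mul_toHat_mem (z : ProfiniteHat G) {U : Subgroup (ProfiniteHat G)}
    (hU : IsOpen (U : Set (ProfiniteHat G))) : ∃ g : G, z⁻¹ * toHat G g ∈ U := by
  obtain ⟨g, hg⟩ := denseRange_toHat.exists_mem_open (hU.preimage (continuous_const_mul z⁻¹))
    ⟨z, by simp⟩
  exact ⟨g, hg⟩

/-- The continuous homomorphism of profinite completions induced by a quotient map. -/
noncomputable def map (A : Subgroup G) [A.Normal] : ProfiniteHat G →* ProfiniteHat (G ⧸ A) :=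
  (ProfiniteGrp.profiniteCompletion.map (GrpCat.ofHom (QuotientGroup.mk' A))).hom.toMonoidHom

variable (A : Subgroup G) [A.Normal]

theorem continuous_map : Continuous (map A) :=
  (ProfiniteGrp.profiniteCompletion.map (GrpCat.ofHom (QuotientGroup.mk' A))).hom.continuous_toFun

theorem map_toHat (g : G) : map A (toHat G g) = toHat (G ⧸ A) g :=
  ConcreteCategory.congr_hom (ProfiniteGrp.ProfiniteCompletion.lift_eta
    (GrpCat.ofHom (QuotientGroup.mk' A) ≫ ProfiniteGrp.ProfiniteCompletion.eta _)) g

theorem map_surjective : Function.Surjective (map A) := by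
  have h₁ : IsClosed (Set.range (map A)) := (isCompact_range (continuous_map A)).isClosed
  have h₂ : Dense (Set.range (map A)) := denseRange_toHat.mono (by
    rintro _ ⟨g, rfl⟩
    obtain ⟨g, rfl⟩ := QuotientGroup.mk_surjective g
    exact ⟨toHat G g, map_toHat A g⟩)
  rw [← Set.range_eq_univ, ← h₁.closure_eq, h₂.closure_eq]

/-- Approximate a kernel element `z` by `g ∈ G`, both modulo `U` and modulo the image `W` of `V` in
`G ⧸ A`. Then `g` differs from an element of `A` by some `v ∈ V`, and `g * v⁻¹` still approximates
`z`. -/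
theorem ker_map : (map A).ker = (A.map (toHat G)).topologicalClosure := by
  apply le_antisymm
  · intro z hz
    rw [MonoidHom.mem_ker] at hz
    refine mem_closure_iff.2 fun O hO hzO => ?_
    obtain ⟨U, hU⟩ := ProfiniteGrp.exist_openNormalSubgroup_sub_open_nhds_of_one
      (G := ProfiniteHat G) (U := (z * ·) ⁻¹' O) (hO.preimage (continuous_const_mul z)) (by simpa)
    let V := U.toFiniteIndexNormalSubgroup.comap (toHat G)
    have : (V.toSubgroup.map (QuotientGroup.mk' A)).FiniteIndex := by
      refine ⟨ne_zero_of_dvd_ne_zero (Subgroup.FiniteIndex.index_ne_zero (H := V.toSubgroup))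
        (Subgroup.index_map_dvd _ (QuotientGroup.mk'_surjective A))⟩
    have : (V.toSubgroup.map (QuotientGroup.mk' A)).Normal :=
      V.isNormal'.map _ (QuotientGroup.mk'_surjective A)
    let W := FiniteIndexNormalSubgroup.ofSubgroup (V.toSubgroup.map (QuotientGroup.mk' A))
    obtain ⟨g, hg₁, hg₂⟩ := exists_inv_mul_toHat_mem z
      (U := U.toSubgroup ⊓ ((proj W).comp (map A)).ker)
      (U.isOpen'.inter ((isOpen_ker_proj W).preimage (continuous_map A)))
    have h : QuotientGroup.mk' A g ∈ W := by
      have : proj W (map A (z⁻¹ * toHat G g)) = 1 := hg₂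
      rw [map_mul, map_inv, hz, inv_one, one_mul, map_toHat, proj_toHat] at this
      exact (QuotientGroup.eq_one_iff _).1 this
    obtain ⟨v, hv, hvg⟩ := h
    have hvg' : v⁻¹ * g ∈ A := QuotientGroup.eq.1 hvg
    have hgv : g * v⁻¹ ∈ A := by
      simpa [mul_assoc] using ‹A.Normal›.conj_mem _ hvg' v
    refine ⟨toHat G (g * v⁻¹), ?_, _, hgv, rfl⟩
    have h₁ : z⁻¹ * toHat G g * (toHat G v)⁻¹ ∈ U.toSubgroup := mul_mem hg₁ (inv_mem hv)
    have := hU h₁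
    simpa [mul_assoc] using this
  · refine Subgroup.topologicalClosure_minimal _ ?_ ?_
    · rintro _ ⟨a, ha, rfl⟩
      rw [MonoidHom.mem_ker, map_toHat, (QuotientGroup.eq_one_iff a).2 ha, map_one]
    · exact isClosed_singleton.preimage (continuous_map A)

/-- By density, one `g ∈ G` represents a central element modulo both `W` and `W₀`; it is then
central modulo `W`. -/
theorem center_eq_bot (h : ∀ W₀ : FiniteIndexNormalSubgroup G,
      ∃ W : FiniteIndexNormalSubgroup G, ∀ e, (∀ y, ⁅e, y⁆ ∈ W) → e ∈ W₀) :
    Subgroup.center (ProfiniteHat G) = ⊥ := by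
  refine (Subgroup.eq_bot_iff_forall _).2 fun z hz => ext_proj fun W₀ => ?_
  obtain ⟨W, hW⟩ := h W₀
  obtain ⟨g, hg₁, hg₂⟩ := exists_inv_mul_toHat_mem z (U := (proj W).ker ⊓ (proj W₀).ker)
    ((isOpen_ker_proj W).inter (isOpen_ker_proj W₀))
  have h₁ : proj W z = g := by
    have : proj W (z⁻¹ * toHat G g) = 1 := hg₁
    rwa [map_mul, map_inv, inv_mul_eq_one] at this
  have h₂ : proj W₀ z = g := by
    have : proj W₀ (z⁻¹ * toHat G g) = 1 := hg₂
    rwa [map_mul, map_inv, inv_mul_eq_one] at this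
  rw [h₂, map_one]
  refine (QuotientGroup.eq_one_iff g).2 (hW g fun y => ?_)
  have h₃ : Commute z (toHat G y) := (Subgroup.mem_center_iff.1 hz _).symm
  have h₄ := h₃.map (proj W)
  rw [h₁, proj_toHat, ← commutatorElement_eq_one_iff_commute] at h₄
  exact (QuotientGroup.eq_one_iff _).1 h₄

theorem topologicalClosure_center_le :
    ((Subgroup.center G).map (toHat G)).topologicalClosure ≤
      Subgroup.center (ProfiniteHat G) := by
  intro z hz
  rw [Subgroup.mem_center_iff]
  intro x
  have h₁ : ∀ g : G, ∀ z ∈ ((Subgroup.center G).map (toHat G)).topologicalClosure,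
      toHat G g * z = z * toHat G g := fun g z hz => by
    refine closure_minimal (t := {z | toHat G g * z = z * toHat G g}) ?_
      (isClosed_eq (by fun_prop) (by fun_prop)) hz
    rintro _ ⟨a, ha, rfl⟩
    change _ * _ = _ * _
    rw [← map_mul, ← map_mul, Subgroup.mem_center_iff.1 ha]
  exact congrFun (denseRange_toHat.equalizer (g := fun x => x * z) (h := fun x => z * x)
    (by fun_prop) (by fun_prop) (funext fun g => h₁ g z hz)) x

/-- If the completion of the quotient of `G` by its centre has trivial centre, then the centre of
the completion of `G` is the closure of the centre of `G`. -/
theorem center_eq_and_exists_equiv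
    (h : Subgroup.center (ProfiniteHat (G ⧸ Subgroup.center G)) = ⊥) :
    Subgroup.center (ProfiniteHat G) =
        ((Subgroup.center G).map (toHat G)).topologicalClosure ∧
      ∃ e : (ProfiniteHat G ⧸ Subgroup.center (ProfiniteHat G)) ≃ₜ*
          ProfiniteHat (G ⧸ Subgroup.center G),
        ∀ g : G, e (QuotientGroup.mk (toHat G g)) =
          toHat (G ⧸ Subgroup.center G) (QuotientGroup.mk g) := by
  let π := map (Subgroup.center G)
  have hπ : Function.Surjective π := map_surjective _
  have hle : Subgroup.center (ProfiniteHat G) ≤ π.ker := fun z hz => by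
    rw [MonoidHom.mem_ker, ← Subgroup.mem_bot, ← h, Subgroup.mem_center_iff]
    intro x
    obtain ⟨x, rfl⟩ := hπ x
    rw [← map_mul, ← map_mul, Subgroup.mem_center_iff.1 hz]
  have hker : π.ker = ((Subgroup.center G).map (toHat G)).topologicalClosure := ker_map _
  have heq := le_antisymm (hle.trans hker.le) topologicalClosure_center_le
  refine ⟨heq, ?_⟩
  let φ := QuotientGroup.lift (Subgroup.center (ProfiniteHat G)) π hle
  have hφ : Continuous φ := continuous_quot_lift _ (continuous_map _)
  have hbij : Function.Bijective φ := by
    refine ⟨(injective_iff_map_eq_one _).2 fun q hq => ?_, fun y => ?_⟩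
    · obtain ⟨z, rfl⟩ := QuotientGroup.mk_surjective q
      refine (QuotientGroup.eq_one_iff z).2 ?_
      rw [heq, ← hker]
      exact hq
    · obtain ⟨z, rfl⟩ := hπ y
      exact ⟨z, rfl⟩
  let e := MulEquiv.ofBijective φ hbij
  exact ⟨{ e with
    continuous_toFun := hφ
    continuous_invFun := (Continuous.homeoOfEquivCompactToT2 (f := e.toEquiv) hφ).symm.continuous },
    fun g => map_toHat _ g⟩

end ProfiniteHat

/-! ### Free-by-cyclic groups modulo their centre -/

namespace FreeByCyclic

variable {N : ℕ} {φ : MulAut (FreeGroup (Fin N))}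

/-- The generator of `ℤ`. -/
def t : FreeByCyclic N φ := SemidirectProduct.inr (Multiplicative.ofAdd 1)

theorem inr_eq_zpow (n : Multiplicative ℤ) :
    (SemidirectProduct.inr n : FreeByCyclic N φ) = t ^ (Multiplicative.toAdd n) := by
  rw [t, ← map_zpow, ← ofAdd_zsmul]
  simp

theorem t_mul_inl_mul_t_inv (f : FreeGroup (Fin N)) :
    (t : FreeByCyclic N φ) * SemidirectProduct.inl f * t⁻¹ = SemidirectProduct.inl (φ f) := by
  rw [t, ← map_inv, ← SemidirectProduct.inl_aut]
  simp

theorem commute_inr_of_commute_t {x : FreeByCyclic N φ} (h : Commute x t) (n : Multiplicative ℤ) :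
    Commute x (SemidirectProduct.inr n) := by
  rw [inr_eq_zpow]
  exact h.zpow_right _

theorem commute_of_commute {x : FreeByCyclic N φ}
    (h₁ : ∀ f, Commute x (SemidirectProduct.inl f)) (h₂ : Commute x t) (y : FreeByCyclic N φ) :
    Commute x y := by
  rw [← SemidirectProduct.inl_left_mul_inr_right y]
  exact (h₁ _).mul_right (commute_inr_of_commute_t h₂ _)

/-- If the centre meets the free normal subgroup nontrivially then the group is abelian. -/
theorem commute_of_inl_mem_center {f : FreeGroup (Fin N)} (hf : f ≠ 1)
    (h : (SemidirectProduct.inl f : FreeByCyclic N φ) ∈ Subgroup.center (FreeByCyclic N φ))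
    (x y : FreeByCyclic N φ) : Commute x y := by
  rw [Subgroup.mem_center_iff] at h
  have := IsFreeGroup.isCyclic_of_central hf fun g => SemidirectProduct.inl_injective
    (φ := zpowersHom (MulAut (FreeGroup (Fin N))) φ) (by simpa using (h (.inl g)).symm)
  obtain ⟨c, hc⟩ := this.exists_generator
  have hφf : φ f = f := SemidirectProduct.inl_injective
    (φ := zpowersHom (MulAut (FreeGroup (Fin N))) φ) (by
      rw [← t_mul_inl_mul_t_inv, h t, mul_inv_cancel_right])
  obtain ⟨k, rfl⟩ := hc f
  have hk : k ≠ 0 := by rintro rfl; simp at hf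
  -- Roots in a free group are unique, so fixing `c ^ k` with `k ≠ 0` fixes `c`.
  have hφc : φ c = c := by
    have : φ c ^ k = c ^ k := by simpa using hφf
    exact zpow_left_injective hk this
  have hφ : ∀ g, φ g = g := fun g => by
    obtain ⟨l, rfl⟩ := hc g
    simp [hφc]
  have hF : ∀ g g' : FreeGroup (Fin N), Commute g g' := fun g g' => by
    obtain ⟨l, rfl⟩ := hc g
    obtain ⟨l', rfl⟩ := hc g'
    exact ((Commute.refl c).zpow_left l).zpow_right l'
  have ht : ∀ g, Commute (t : FreeByCyclic N φ) (SemidirectProduct.inl g) := fun g => by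
    have := t_mul_inl_mul_t_inv (φ := φ) g
    rwa [hφ, mul_inv_eq_iff_eq_mul] at this
  have hl : ∀ g (z : FreeByCyclic N φ), Commute (SemidirectProduct.inl g) z := fun g =>
    commute_of_commute (fun g' => (hF g g').map SemidirectProduct.inl) (ht g).symm
  exact commute_of_commute (fun g => (hl g x).symm)
    ((commute_of_commute ht (Commute.refl t) x).symm) y

theorem center_profiniteHat_quotient_center (hZ : Subgroup.center (FreeByCyclic N φ) ≠ ⊥) :
    Subgroup.center (ProfiniteHat (FreeByCyclic N φ ⧸ Subgroup.center (FreeByCyclic N φ))) =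
      ⊥ := by
  set Z := Subgroup.center (FreeByCyclic N φ) with hZdef
  refine ProfiniteHat.center_eq_bot fun W₀ => ?_
  by_cases hF : ∃ f : FreeGroup (Fin N), f ≠ 1 ∧ (SemidirectProduct.inl f : FreeByCyclic N φ) ∈ Z
  · obtain ⟨f, hf, hfZ⟩ := hF
    refine ⟨W₀, fun e _ => ?_⟩
    obtain ⟨e, rfl⟩ := QuotientGroup.mk_surjective e
    have : e ∈ Z := Subgroup.mem_center_iff.2 fun y => commute_of_inl_mem_center hf hfZ y e
    rw [(QuotientGroup.eq_one_iff e).2 this]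
    exact one_mem W₀
  push Not at hF
  have hF' : ∀ f : FreeGroup (Fin N), (SemidirectProduct.inl f : FreeByCyclic N φ) ∈ Z → f = 1 :=
    fun f h => by_contra fun hf => hF f hf h
  let ι : FreeGroup (Fin N) →* FreeByCyclic N φ ⧸ Z :=
    (QuotientGroup.mk' Z).comp SemidirectProduct.inl
  have hι : Function.Injective ι := (injective_iff_map_eq_one ι).2 fun f hf =>
    hF' f ((QuotientGroup.eq_one_iff _).1 hf)
  have hrange : (SemidirectProduct.inl : FreeGroup (Fin N) →* FreeByCyclic N φ).range =
      (SemidirectProduct.rightHom : FreeByCyclic N φ →* _).ker :=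
    SemidirectProduct.range_inl_eq_ker_rightHom
  have hnormal : (SemidirectProduct.inl : FreeGroup (Fin N) →* FreeByCyclic N φ).range.Normal := by
    rw [hrange]; infer_instance
  have hι' : ι.range = (SemidirectProduct.inl : FreeGroup (Fin N) →* FreeByCyclic N φ).range.map
      (QuotientGroup.mk' Z) := MonoidHom.range_comp _ _
  have : ι.range.Normal := by
    rw [hι']
    exact hnormal.map _ (QuotientGroup.mk'_surjective Z)
  have : IsFreeGroup ι.range := IsFreeGroup.ofMulEquiv (MonoidHom.ofInjective hι)
  have hfi : ι.range.FiniteIndex := by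
    obtain ⟨⟨z, hz⟩, hz₁⟩ := Subgroup.ne_bot_iff_exists_ne_one.1 hZ
    set n := Multiplicative.toAdd z.right with hn
    have hn₀ : n ≠ 0 := by
      intro h
      have hzr : SemidirectProduct.inl z.left = z := by
        conv_rhs => rw [← SemidirectProduct.inl_left_mul_inr_right z]
        rw [show z.right = 1 from h, map_one, mul_one]
      refine hz₁ (Subtype.ext ?_)
      change z = 1
      rw [← hzr, hF' z.left (hzr ▸ hz), map_one]
    have : NeZero n.natAbs := ⟨by simpa using hn₀⟩
    let ψ : FreeByCyclic N φ →* Multiplicative (ZMod n.natAbs) :=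
      (AddMonoidHom.toMultiplicative (Int.castAddHom (ZMod n.natAbs))).comp
        SemidirectProduct.rightHom
    -- If `n` divides the `ℤ`-component of `x`, dividing by a power of the central `z` moves `x`
    -- into `F_N` without changing its class modulo `Z`.
    have hle : ψ.ker ≤ ι.range.comap (QuotientGroup.mk' Z) := fun x hx => by
      have hx' : ((Multiplicative.toAdd x.right : ℤ) : ZMod n.natAbs) = 0 := hx
      rw [ZMod.intCast_zmod_eq_zero_iff_dvd, Int.natAbs_dvd] at hx'
      obtain ⟨d, hd⟩ := hx'
      have hxz : x * (z ^ d)⁻¹ ∈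
          (SemidirectProduct.inl : FreeGroup (Fin N) →* FreeByCyclic N φ).range := by
        rw [hrange, MonoidHom.mem_ker, map_mul, map_inv, map_zpow, mul_inv_eq_one]
        change x.right = z.right ^ d
        refine Multiplicative.toAdd.injective ?_
        rw [hd, toAdd_zpow, smul_eq_mul, mul_comm]
      obtain ⟨f, hf⟩ := hxz
      refine ⟨f, ?_⟩
      change QuotientGroup.mk' Z (SemidirectProduct.inl f) = _
      rw [hf, map_mul, map_inv, map_zpow,
        show QuotientGroup.mk' Z z = 1 from (QuotientGroup.eq_one_iff z).2 hz]
      simp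
    have h := Subgroup.finiteIndex_of_le hle
    exact ⟨by
      rw [← Subgroup.index_comap_of_surjective _ (QuotientGroup.mk'_surjective Z)]
      exact h.index_ne_zero⟩
  refine (ι.range.exists_le_forall_commutator_mem_of_isFreeGroup ?_ W₀).imp fun W h => h.2
  intro e he
  obtain ⟨x, rfl⟩ := QuotientGroup.mk_surjective e
  refine (QuotientGroup.eq_one_iff x).2 ?_
  have hcomm : ∀ y, ⁅x, y⁆ ∈ Z := fun y => by
    rw [← QuotientGroup.eq_one_iff]
    exact commutatorElement_eq_one_iff_commute.2 (he y)
  -- The commutator lies in `Z ∩ F_N`, which is trivial here; as `ℤ` is abelian, every commutator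
  -- lies in `F_N`.
  have key : ∀ y, ⁅x, y⁆ ∈ (SemidirectProduct.inl : FreeGroup (Fin N) →* FreeByCyclic N φ).range →
      Commute x y := fun y ⟨f, hf⟩ => by
    rw [← commutatorElement_eq_one_iff_commute, ← hf, hF' f (hf ▸ hcomm y), map_one]
  have h : ∀ y, Commute x y := fun y => key y (by
    rw [hrange, MonoidHom.mem_ker, map_commutatorElement, commutatorElement_eq_one_iff_commute]
    exact Commute.all _ _)
  exact Subgroup.mem_center_iff.2 fun y => (h y).symm

end FreeByCyclic

theorem mainTheorem9 (N : ℕ) (φ : MulAut (FreeGroup (Fin N)))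
    (hZ : Subgroup.center (FreeByCyclic N φ) ≠ ⊥) :
    Subgroup.center (ProfiniteHat (FreeByCyclic N φ)) =
        ((Subgroup.center (FreeByCyclic N φ)).map
          (toHat (FreeByCyclic N φ))).topologicalClosure ∧
      ∃ e : (ProfiniteHat (FreeByCyclic N φ) ⧸
            Subgroup.center (ProfiniteHat (FreeByCyclic N φ))) ≃ₜ*
          ProfiniteHat (FreeByCyclic N φ ⧸ Subgroup.center (FreeByCyclic N φ)),
        ∀ g : FreeByCyclic N φ,
          e (QuotientGroup.mk (toHat (FreeByCyclic N φ) g)) =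
            toHat (FreeByCyclic N φ ⧸ Subgroup.center (FreeByCyclic N φ))
              (QuotientGroup.mk g) :=
  ProfiniteHat.center_eq_and_exists_equiv (FreeByCyclic.center_profiniteHat_quotient_center hZ)
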